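/- Let $n,m\ge 0$ be integers, $[n]=\{1,\dots,n\}$, and let $E=\binom{[n]}{2}$ be the edge set of the complete graph $K_n$, $d=n+\binom n2$. Vectors with $d$ entries are indexed by $[n]\sqcup E$; $\pi:\mathbb Z^d\to\mathbb Z^n$ is the projection to the first $n$ (vertex) coordinates. For $S\subseteq[n]$ let $a_S\in\{0,1\}^d$ be the characteristic vector of the clique on $S$: $(a_S)_i=1$ iff $i\in S$, and $(a_S)_{ij}=1$ iff $i,j\in S$. A function $v:2^{[n]}\to\mathbb R$ is a graphical valuation with underlying graph $K_n$ if there is $w\in\mathbb R^d$ with $v(S)=\langle w,a_S\rangle=\sum_{i\in S}w_i+\sum_{ij\in E,\ i,j\in S}w_{ij}$ for all $S\subseteq[n]$. A price vector $p\in\mathbb R^d$ charges $\langle p,a_S\rangle$ for the bundle $S$, the same for every agent, and the demand set of an agent with valuation $v$ at $p$ is $D(v,p)=\operatorname{argmax}_{S\subseteq[n]}\{v(S)-\langle p,a_S\rangle\}$. An auction with $m$ agents with valuations $v^1,\dots,v^m$ has a competitive equilibrium at $a\in\mathbb Z^d$ and price $p$ if there are $S^1,\dots,S^m\subseteq[n]$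 with $a=\sum_{b=1}^m a_{S^b}$ and $S^b\in D(v^b,p)$ for every $b$. **Theorem.** Let $a^*\in\{0,1,\dots,m\}^n$. Then there is an $a\in\pi^{-1}(a^*)$ such that for every choice of graphical valuations $v^1,\dots,v^m$ with underlying graph $K_n$ there is a price $p\in\mathbb R^d$ such that the auction has a competitive equilibrium at $a$ and $p$. Moreover, such an $a$ is given explicitly by $a_i=a^*_i$ for $i\in[n]$ and $a_{ij}=\min(a^*_i,a^*_j)$ for $ij\in E$; it is a sum of characteristic vectors of nested cliques, namely $a=\sum_{t=1}^m a_{K_t}$ with $K_t=\{i\in[n]: a^*_i\ge t\}$, $K_m\subseteq\dots\subseteq K_1$. -/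

import Mathlib

open scoped BigOperators

namespace GraphicalAuction

/-- The index set `[n] ⊔ E(G)`: one coordinate for every vertex and every edge of `G`. -/
abbrev Coord {n : ℕ} (G : SimpleGraph (Fin n)) : Type := Fin n ⊕ G.edgeSet

open Classical in
/-- The vector `a_S ∈ {0,1}^{[n] ⊔ E(G)}` of a set of types `S ⊆ [n]`: the vertex coordinate `i`
is `1` iff `i ∈ S`, and the coordinate of an edge is `1` iff both its endpoints are in `S`.
For `G = K_n` it is the characteristic vector of the clique with vertex set `S`. -/
noncomputable def bundleVec {n : ℕ} (G : SimpleGraph (Fin n)) (S : Finset (Fin n)) :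
    Coord G → ℤ
  | Sum.inl i => if i ∈ S then 1 else 0
  | Sum.inr e => if ∀ i ∈ (e : Sym2 (Fin n)), i ∈ S then 1 else 0

/-- The coordinate projection `π : ℤ^{[n] ⊔ E(G)} → ℤ^n` that forgets the edge coordinates. -/
def proj {n : ℕ} (G : SimpleGraph (Fin n)) (a : Coord G → ℤ) : Fin n → ℤ :=
  fun i => a (Sum.inl i)

open Classical in
/-- The graphical set function on `2^[n]` with weights `w` on the vertices and edges of `G`:
`S ↦ ∑_{i ∈ S} w_i + ∑_{ij ∈ E(G), i, j ∈ S} w_{ij}`. -/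
noncomputable def graphicalFun {n : ℕ} (G : SimpleGraph (Fin n)) (w : Coord G → ℝ)
    (S : Finset (Fin n)) : ℝ :=
  ∑ i ∈ S, w (Sum.inl i) +
    ∑ e ∈ (Finset.univ.filter fun e : G.edgeSet => ∀ i ∈ (e : Sym2 (Fin n)), i ∈ S),
      w (Sum.inr e)

/-- `v : 2^[n] → ℝ` is a graphical valuation with underlying value graph `G`. -/
def IsGraphicalValuation {n : ℕ} (G : SimpleGraph (Fin n)) (v : Finset (Fin n) → ℝ) : Prop :=
  ∃ w : Coord G → ℝ, ∀ S, v S = graphicalFun G w S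

/-- The demand set of an agent with valuation `v` at the graphical price `p`: the bundles `S`
that maximize the utility `v(S) - p(S)` over all subsets of `[n]`. -/
def demandSet {n : ℕ} (G : SimpleGraph (Fin n)) (v : Finset (Fin n) → ℝ) (p : Coord G → ℝ) :
    Set (Finset (Fin n)) :=
  {S | ∀ T, v T - graphicalFun G p T ≤ v S - graphicalFun G p S}

/-- The auction with `m` agents with valuations `v b` has a competitive equilibrium at
`a ∈ ℤ^{[n] ⊔ E(G)}` and the anonymous graphical price `p`: there is an allocation
`(a^1, …, a^m)` with `a = ∑ a^b`, where each `a^b` is the vector of a bundle in the demand set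
of agent `b`. -/
def HasCompetitiveEquilibrium {n m : ℕ} (G : SimpleGraph (Fin n))
    (v : Fin m → Finset (Fin n) → ℝ) (a : Coord G → ℤ) (p : Coord G → ℝ) : Prop :=
  ∃ S : Fin m → Finset (Fin n),
    a = ∑ b, bundleVec G (S b) ∧ ∀ b, S b ∈ demandSet G (v b) p

end GraphicalAuction

/-! Treat the cliques `K t` as `m` items, one per agent, with values `v b (K t)`. An optimal
assignment is supported by item prices `q` (`exists_assignment_price`). Since the `K t` form a
chain, vertex prices realize `q` on them up to a common constant (`exists_vertex_price`). Edge
prices keep demand on the chain: `levelPenalty` is graphical up to a constant, vanishes on every `K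
t` and is at least 1 on all other sets, so a large multiple of it makes those unattractive. -/

namespace GraphicalAuction

/-! ### Potentials and supporting prices for the assignment problem. -/

section Potential

variable {α : Type*}

/-- The total weight of the consecutive steps of a list. -/
def pathWeight (c : α → α → ℝ) : List α → ℝ
  | x :: y :: l => c x y + pathWeight c (y :: l)
  | _ => 0

theorem pathWeight_append_cons (c : α → α → ℝ) (x : α) (l₂ : List α) :
    ∀ l₁ : List α, pathWeight c (l₁ ++ x :: l₂) =
      pathWeight c (l₁ ++ [x]) + pathWeight c (x :: l₂)
  | [] => by simp [pathWeight]
  | [y] => by simp [pathWeight]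
  | y :: z :: l => by
    have h := pathWeight_append_cons c x l₂ (z :: l)
    simp only [List.cons_append, pathWeight] at h ⊢
    rw [h, add_assoc]

variable [Fintype α] [DecidableEq α]

/-- Turns the hypothesis on permutations into one on closed paths. Prepending `x` multiplies the
cycle by a swap, which changes it only at `x` and at the last entry. -/
theorem sum_formPerm_cons (c : α → α → ℝ) (h0 : ∀ x, c x x = 0) (l : List α) :
    ∀ x : α, (x :: l).Nodup → ∑ z, c z ((x :: l).formPerm z) =
      pathWeight c (x :: l) + c ((x :: l).getLast (List.cons_ne_nil _ _)) x := by
  induction l with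
  | nil => intro x _; simp [pathWeight, h0]
  | cons y l ih =>
    intro x hx
    have hyl : (y :: l).Nodup := (List.nodup_cons.1 hx).2
    have hxl : x ∉ y :: l := (List.nodup_cons.1 hx).1
    have hlast : (y :: l).getLast (List.cons_ne_nil _ _) ∈ y :: l := List.getLast_mem _
    have hσL := List.formPerm_apply_getLast y l
    have hσx : (y :: l).formPerm x = x := List.formPerm_apply_of_notMem hxl
    specialize ih y hyl
    rw [List.formPerm_cons_cons, List.getLast_cons (List.cons_ne_nil y l)]
    generalize (y :: l).getLast (List.cons_ne_nil _ _) = L at *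
    generalize (y :: l).formPerm = σ at *
    have hxL : x ≠ L := fun h => hxl (h ▸ hlast)
    have key : ∑ z, (c z ((Equiv.swap x y * σ) z) - c z (σ z)) =
        ∑ z ∈ {x, L}, (c z ((Equiv.swap x y * σ) z) - c z (σ z)) := by
      symm
      refine Finset.sum_subset (Finset.subset_univ _) fun z _ hz => ?_
      simp only [Finset.mem_insert, Finset.mem_singleton, not_or] at hz
      have h1 : σ z ≠ x := fun h => hz.1 (σ.injective (h.trans hσx.symm))
      have h2 : σ z ≠ y := fun h => hz.2 (σ.injective (h.trans hσL.symm))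
      rw [Equiv.Perm.mul_apply, Equiv.swap_apply_of_ne_of_ne h1 h2, sub_self]
    rw [Finset.sum_pair hxL, Finset.sum_sub_distrib, Equiv.Perm.mul_apply, Equiv.Perm.mul_apply,
      hσL, hσx, Equiv.swap_apply_left, Equiv.swap_apply_right, h0, ih] at key
    simp only [pathWeight]
    linarith

/-- Weights without positive cycles admit a potential. -/
theorem exists_potential (c : α → α → ℝ) (h0 : ∀ x, c x x = 0)
    (hc : ∀ τ : Equiv.Perm α, ∑ x, c x (τ x) ≤ 0) :
    ∃ q : α → ℝ, ∀ x y, c x y + q y ≤ q x := by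
  have hmax : ∀ x : α, ∃ l : List α, (x :: l).Nodup ∧
      ∀ l' : List α, (x :: l').Nodup → pathWeight c (x :: l') ≤ pathWeight c (x :: l) := by
    intro x
    have hfin : {l : List α | l.Nodup}.Finite :=
      inferInstanceAs (Finite {l : List α // l.Nodup})
    have hfin' : {l : List α | (x :: l).Nodup}.Finite :=
      hfin.subset fun l hl => (List.nodup_cons.1 hl).2
    obtain ⟨l, hl, h⟩ := Set.exists_max_image _ (fun l => pathWeight c (x :: l)) hfin'
      ⟨[], by simp⟩
    exact ⟨l, hl, h⟩
  choose best hnodup hbest using hmax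
  -- The potential at `x` is the largest weight of a simple path starting at `x`.
  refine ⟨fun x => pathWeight c (x :: best x), fun x y => ?_⟩
  -- If the best path from `y` meets `x`, its part up to `x` closes to a cycle of weight at most 0;
  -- the rest competes at `x`. Otherwise prepend `x`.
  by_cases hx : x ∈ y :: best y
  · obtain ⟨l₁, l₂, h⟩ := List.append_of_mem hx
    have hn : (l₁ ++ x :: l₂).Nodup := h ▸ hnodup y
    have h1 : pathWeight c (x :: l₂) ≤ pathWeight c (x :: best x) :=
      hbest x l₂ hn.of_append_right
    have h2 : (l₁ ++ [x]).Nodup :=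
      hn.sublist (List.Sublist.append_left (by simp) l₁)
    have h3 : c x y + pathWeight c (l₁ ++ [x]) ≤ 0 := by
      obtain ⟨l, hl⟩ : ∃ l, l₁ ++ [x] = y :: l := by
        cases l₁ with
        | nil => exact ⟨[], by simp_all⟩
        | cons z l => exact ⟨l ++ [x], by simp_all⟩
      have h4 := sum_formPerm_cons c h0 l y (hl ▸ h2)
      have h5 : (y :: l).getLast (List.cons_ne_nil _ _) = x := by
        simp [← hl]
      rw [h5] at h4
      have h6 := hc (y :: l).formPerm
      rw [hl]
      linarith
    simp only [h, pathWeight_append_cons c x l₂ l₁]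
    linarith
  · exact hbest x (y :: best y) (List.nodup_cons.2 ⟨hx, hnodup y⟩)

/-- An assignment problem has an optimal assignment supported by item prices. -/
theorem exists_assignment_price (W : α → α → ℝ) :
    ∃ (σ : Equiv.Perm α) (q : α → ℝ), ∀ b t, W b t - q t ≤ W b (σ b) - q (σ b) := by
  obtain ⟨σ, hσ⟩ := Finite.exists_max fun σ : Equiv.Perm α => ∑ b, W b (σ b)
  -- The weight of `(s, t)` is the gain of the holder of `t` on moving to `s`; summed along a
  -- permutation, it is the change in welfare of an optimal assignment.
  obtain ⟨q, hq⟩ := exists_potential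
    (fun s t => W (σ.symm t) s - W (σ.symm t) t) (by simp) (fun τ => by
      have h1 : ∑ x, W (σ.symm (τ x)) x ≤ ∑ b, W b (σ b) := by
        refine le_trans (le_of_eq ?_) (hσ (τ.symm * σ))
        refine Fintype.sum_equiv (τ.trans σ.symm) _ _ fun x => ?_
        simp
      have h2 : ∑ x, W (σ.symm (τ x)) (τ x) = ∑ b, W b (σ b) :=
        Fintype.sum_equiv (τ.trans σ.symm) _ _ fun x => by simp
      rw [Finset.sum_sub_distrib]
      linarith)
  refine ⟨σ, q, fun b t => ?_⟩
  have := hq t (σ b)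
  simp only [Equiv.symm_apply_apply] at this
  linarith

end Potential

/-! ### Graphical valuations, the penalty and the equilibrium price. -/

section Valuation

variable {n : ℕ} {G : SimpleGraph (Fin n)}

theorem IsGraphicalValuation.add {f g : Finset (Fin n) → ℝ} (hf : IsGraphicalValuation G f)
    (hg : IsGraphicalValuation G g) : IsGraphicalValuation G fun S => f S + g S := by
  obtain ⟨u, hu⟩ := hf
  obtain ⟨w, hw⟩ := hg
  refine ⟨u + w, fun S => ?_⟩
  simp only [hu, hw, graphicalFun, Pi.add_apply, Finset.sum_add_distrib]
  ring

theorem IsGraphicalValuation.const_mul {f : Finset (Fin n) → ℝ} (hf : IsGraphicalValuation G f)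
    (r : ℝ) : IsGraphicalValuation G fun S => r * f S := by
  obtain ⟨u, hu⟩ := hf
  refine ⟨r • u, fun S => ?_⟩
  simp only [hu, graphicalFun, Pi.smul_apply, smul_eq_mul, ← Finset.mul_sum, mul_add]

theorem IsGraphicalValuation.zero : IsGraphicalValuation G fun _ => 0 :=
  ⟨0, fun S => by simp [graphicalFun]⟩

theorem IsGraphicalValuation.sub {f g : Finset (Fin n) → ℝ} (hf : IsGraphicalValuation G f)
    (hg : IsGraphicalValuation G g) : IsGraphicalValuation G fun S => f S - g S := by
  simpa [sub_eq_add_neg] using hf.add (hg.const_mul (-1))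

theorem IsGraphicalValuation.sum {ι : Type*} (s : Finset ι) {f : ι → Finset (Fin n) → ℝ}
    (hf : ∀ i ∈ s, IsGraphicalValuation G (f i)) :
    IsGraphicalValuation G fun S => ∑ i ∈ s, f i S := by
  classical
  induction s using Finset.induction_on with
  | empty => simpa using IsGraphicalValuation.zero
  | insert i s hi ih =>
    simp only [Finset.sum_insert hi]
    exact (hf i (by simp)).add (ih fun j hj => hf j (by simp [hj]))

theorem isGraphicalValuation_sum_vertex (x : Fin n → ℝ) :
    IsGraphicalValuation G fun S => ∑ i ∈ S, x i :=
  ⟨Sum.elim x 0, fun S => by simp [graphicalFun]⟩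

theorem isGraphicalValuation_mem (i : Fin n) :
    IsGraphicalValuation G fun S => if i ∈ S then 1 else 0 := by
  convert isGraphicalValuation_sum_vertex (G := G) (Pi.single i 1) using 2 with S
  simp [Pi.single_apply]

theorem isGraphicalValuation_mem_and_mem {i j : Fin n} (h : G.Adj i j) :
    IsGraphicalValuation G fun S => if i ∈ S ∧ j ∈ S then 1 else 0 := by
  classical
  refine ⟨Sum.elim 0 (Pi.single ⟨s(i, j), h⟩ 1), fun S => ?_⟩
  simp [graphicalFun, Pi.single_apply]

/-- The number of pairs `i, j` with `a i ≤ a j` that violate `i ∈ S → j ∈ S`, plus the number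
of elements of `S` at level `0`, plus the number of elements outside `S` at level `m`. -/
noncomputable def levelPenalty (a : Fin n → ℕ) (m : ℕ) (S : Finset (Fin n)) : ℝ :=
  (∑ i, ∑ j, if a i ≤ a j ∧ i ∈ S ∧ j ∉ S then (1 : ℝ) else 0) +
    (∑ i, if a i = 0 ∧ i ∈ S then (1 : ℝ) else 0) +
    ∑ i, if a i = m ∧ i ∉ S then (1 : ℝ) else 0

/-- The indicator of `i ∈ S, j ∉ S` is that of `i ∈ S` minus that of `i, j ∈ S`, an edge term of the
complete graph. The constant is the penalty of `∅`, where graphical functions vanish. -/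
theorem exists_isGraphicalValuation_levelPenalty (a : Fin n → ℕ) (m : ℕ) :
    ∃ k : ℝ, IsGraphicalValuation (⊤ : SimpleGraph (Fin n)) fun S => levelPenalty a m S - k := by
  refine ⟨∑ i, if a i = m then 1 else 0, ?_⟩
  have h1 : IsGraphicalValuation (⊤ : SimpleGraph (Fin n)) fun S =>
      ∑ i, ∑ j, if a i ≤ a j ∧ i ∈ S ∧ j ∉ S then (1 : ℝ) else 0 := by
    refine .sum _ fun i _ => .sum _ fun j _ => ?_
    by_cases hij : a i ≤ a j ∧ i ≠ j
    · convert (isGraphicalValuation_mem (G := ⊤) i).sub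
        (isGraphicalValuation_mem_and_mem (G := ⊤) (SimpleGraph.top_adj _ _ |>.2 hij.2)) using 2
        with S
      by_cases hi : i ∈ S <;> by_cases hj : j ∈ S <;> simp [hi, hj, hij.1]
    · convert IsGraphicalValuation.zero (G := (⊤ : SimpleGraph (Fin n))) using 2 with S
      grind
  have h2 : IsGraphicalValuation (⊤ : SimpleGraph (Fin n)) fun S =>
      ∑ i, if a i = 0 ∧ i ∈ S then (1 : ℝ) else 0 := by
    refine .sum _ fun i _ => ?_
    convert (isGraphicalValuation_mem (G := ⊤) i).const_mul (if a i = 0 then 1 else 0) using 2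
    split_ifs <;> simp_all
  have h3 : IsGraphicalValuation (⊤ : SimpleGraph (Fin n)) fun S =>
      ∑ i, ((if a i = m ∧ i ∉ S then (1 : ℝ) else 0) - if a i = m then 1 else 0) := by
    refine .sum _ fun i _ => ?_
    convert (isGraphicalValuation_mem (G := ⊤) i).const_mul (if a i = m then -1 else 0) using 2
    split_ifs <;> simp_all
  convert (h1.add h2).add h3 using 2 with S
  rw [levelPenalty, Finset.sum_sub_distrib]
  ring

theorem levelPenalty_superlevel {a : Fin n → ℕ} {m t : ℕ} {S : Finset (Fin n)} (ht : t < m)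
    (hS : ∀ i, i ∈ S ↔ t + 1 ≤ a i) : levelPenalty a m S = 0 := by
  have h1 : ∀ i j, ¬(a i ≤ a j ∧ i ∈ S ∧ j ∉ S) := fun i j => by rw [hS, hS]; omega
  have h2 : ∀ i, ¬(a i = 0 ∧ i ∈ S) := fun i => by rw [hS]; omega
  have h3 : ∀ i, ¬(a i = m ∧ i ∉ S) := fun i => by rw [hS]; omega
  simp [levelPenalty, h1, h2, h3]

/-- Each violation costs 1, so penalty below 1 means none: `S` is then upward closed in `a`, and its
threshold is the minimum of `a` on `S`. -/
theorem exists_superlevel_or_one_le_levelPenalty {a : Fin n → ℕ} {m : ℕ} (hm : 0 < m)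
    (ha : ∀ i, a i ≤ m) (S : Finset (Fin n)) :
    (∃ t < m, ∀ i, i ∈ S ↔ t + 1 ≤ a i) ∨ 1 ≤ levelPenalty a m S := by
  have n1 : ∀ i j, 0 ≤ if a i ≤ a j ∧ i ∈ S ∧ j ∉ S then (1 : ℝ) else 0 := fun i j => by
    positivity
  have n2 : ∀ i, 0 ≤ if a i = 0 ∧ i ∈ S then (1 : ℝ) else 0 := fun i => by positivity
  have n3 : ∀ i, 0 ≤ if a i = m ∧ i ∉ S then (1 : ℝ) else 0 := fun i => by positivity
  have s1 := Finset.sum_nonneg fun i (_ : i ∈ Finset.univ) =>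
    Finset.sum_nonneg fun j (_ : j ∈ Finset.univ) => n1 i j
  have s2 := Finset.sum_nonneg fun i (_ : i ∈ Finset.univ) => n2 i
  have s3 := Finset.sum_nonneg fun i (_ : i ∈ Finset.univ) => n3 i
  rw [or_iff_not_imp_right, levelPenalty]
  intro hlt
  have h1 : ∀ i j, a i ≤ a j → i ∈ S → j ∈ S := by
    intro i j hij hi
    by_contra hj
    have e1 := Finset.single_le_sum (fun j _ => n1 i j) (Finset.mem_univ j)
    have e2 := Finset.single_le_sum
      (fun i _ => Finset.sum_nonneg fun j (_ : j ∈ Finset.univ) => n1 i j) (Finset.mem_univ i)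
    rw [if_pos ⟨hij, hi, hj⟩] at e1
    linarith
  have h2 : ∀ i, i ∈ S → a i ≠ 0 := by
    intro i hi h
    have e := Finset.single_le_sum (fun i _ => n2 i) (Finset.mem_univ i)
    rw [if_pos ⟨h, hi⟩] at e
    linarith
  have h3 : ∀ i, a i = m → i ∈ S := by
    intro i h
    by_contra hi
    have e := Finset.single_le_sum (fun i _ => n3 i) (Finset.mem_univ i)
    rw [if_pos ⟨h, hi⟩] at e
    linarith
  rcases S.eq_empty_or_nonempty with rfl | hne
  -- The empty set violates nothing only if level `m` is empty, and then it is the top superlevel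
  -- set.
  · refine ⟨m - 1, by omega, fun i => ?_⟩
    have := h3 i
    have := ha i
    simp at *
    omega
  · obtain ⟨k, hk, hmin⟩ := Finset.exists_min_image S a hne
    have := h2 k hk
    have := ha k
    refine ⟨a k - 1, by omega, fun i => ⟨fun hi => ?_, fun hi => h1 k i (by omega) hk⟩⟩
    have := hmin i hi
    omega

/-- Prices of the superlevel sets of `a` can be realized by vertex prices, up to a constant. -/
theorem exists_vertex_price (a : Fin n → ℕ) (m : ℕ) (ha : ∀ i, a i ≤ m) (q : ℕ → ℝ)
    (hq : ∀ t < m, (∀ i, a i ≠ t + 1) → q t = q (t + 1)) :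
    ∃ x : Fin n → ℝ, ∀ t ≤ m, ∑ i with t + 1 ≤ a i, x i = q t - q m := by
  -- The drop of `q` at each level is shared equally by the vertices there, so sums over superlevel
  -- sets telescope.
  refine ⟨fun i => (q (a i - 1) - q (a i)) / (Finset.univ.filter fun j => a j = a i).card,
    fun t ht => ?_⟩
  induction ht using Nat.decreasingInduction with
  | self =>
    rw [sub_self, Finset.sum_eq_zero]
    intro i hi
    have := ha i
    have := (Finset.mem_filter.1 hi).2
    omega
  | of_succ t ht ih =>
    have hsplit : (Finset.univ.filter fun i => t + 1 ≤ a i) =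
        (Finset.univ.filter fun i => t + 1 + 1 ≤ a i) ∪
          Finset.univ.filter fun i => a i = t + 1 := by
      ext i
      simp only [Finset.mem_filter, Finset.mem_univ, true_and, Finset.mem_union]
      omega
    have hdisj : Disjoint (Finset.univ.filter fun i => t + 1 + 1 ≤ a i)
        (Finset.univ.filter fun i => a i = t + 1) := by
      rw [Finset.disjoint_filter]
      omega
    have hfib : ∑ i with a i = t + 1, (q (a i - 1) - q (a i)) /
        ((Finset.univ.filter fun j => a j = a i).card : ℝ) = q t - q (t + 1) := by
      rw [Finset.sum_congr rfl (g := fun _ => (q t - q (t + 1)) /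
        ((Finset.univ.filter fun j => a j = t + 1).card : ℝ)) (fun i hi => by
          rw [(Finset.mem_filter.1 hi).2, Nat.add_sub_cancel]), Finset.sum_const, nsmul_eq_mul]
      rcases (Finset.univ.filter fun j => a j = t + 1).eq_empty_or_nonempty with h | h
      · have : ∀ i, a i ≠ t + 1 := fun i hi => by
          simpa using Finset.filter_eq_empty_iff.1 h (Finset.mem_univ i) hi
        rw [hq t ht this]
        simp
      · have : ((Finset.univ.filter fun j => a j = t + 1).card : ℝ) ≠ 0 := by
          exact_mod_cast h.card_pos.ne'
        field_simp
    rw [hsplit, Finset.sum_union hdisj, ih, hfib]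
    ring

theorem exists_competitive_equilibrium_superlevel {m : ℕ} {a : Fin n → ℕ} (ha : ∀ i, a i ≤ m)
    (K : Fin m → Finset (Fin n)) (hK : ∀ t i, i ∈ K t ↔ (t : ℕ) + 1 ≤ a i)
    (v : Fin m → Finset (Fin n) → ℝ) :
    ∃ p : Coord (⊤ : SimpleGraph (Fin n)) → ℝ,
      HasCompetitiveEquilibrium ⊤ v (∑ t, bundleVec ⊤ (K t)) p := by
  rcases Nat.eq_zero_or_pos m with rfl | hm
  · exact ⟨0, Fin.elim0, by simp, fun b => b.elim0⟩
  obtain ⟨σ, q, hq⟩ := exists_assignment_price fun b t => v b (K t)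
  -- The agent holding `s` would switch to an equal set at a lower price.
  have hq' : ∀ s t, K s = K t → q s ≤ q t := by
    intro s t h
    have := hq (σ.symm s) t
    simp only [Equiv.apply_symm_apply, h] at this
    linarith
  -- Extending by `q m = q (m - 1)` is forced: if level `m` is empty, the last clique is `∅`, whose
  -- price is 0.
  obtain ⟨x, hx⟩ := exists_vertex_price a m ha (fun t => q ⟨min t (m - 1), by omega⟩) (by
    intro t ht hne
    have hKK : K ⟨min t (m - 1), by omega⟩ = K ⟨min (t + 1) (m - 1), by omega⟩ := by
      ext i
      have := hne i
      have := ha i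
      simp only [hK]
      omega
    exact le_antisymm (hq' _ _ hKK) (hq' _ _ hKK.symm))
  have hxK : ∀ t : Fin m, ∑ i ∈ K t, x i = q t - q ⟨min m (m - 1), by omega⟩ := by
    intro t
    rw [← Finset.sum_congr (s₁ := Finset.univ.filter fun i => (t : ℕ) + 1 ≤ a i)
      (by ext i; simp [hK]) fun _ _ => rfl, hx t t.2.le]
    congr 2
    ext
    simp only
    omega
  obtain ⟨k, hk⟩ := exists_isGraphicalValuation_levelPenalty a m
  -- `M` bounds every agent's gain from leaving the assigned clique at vertex prices `x`; a penalty
  -- of at least `M` cancels it.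
  obtain ⟨M, hM⟩ := (Set.finite_range fun y : Fin m × Finset (Fin n) =>
    (v y.1 y.2 - ∑ i ∈ y.2, x i) -
      (v y.1 (K (σ y.1)) - ∑ i ∈ K (σ y.1), x i)).bddAbove
  have hM' : ∀ b S, (v b S - ∑ i ∈ S, x i) -
      (v b (K (σ b)) - ∑ i ∈ K (σ b), x i) ≤ M := fun b S => hM ⟨(b, S), rfl⟩
  obtain ⟨p, hp⟩ := (isGraphicalValuation_sum_vertex (G := ⊤) x).add (hk.const_mul M)
  refine ⟨p, fun b => K (σ b), (Equiv.sum_comp σ fun t => bundleVec ⊤ (K t)).symm,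
    fun b S => ?_⟩
  have hM0 : 0 ≤ M := by simpa using hM' b (K (σ b))
  rw [← hp, ← hp]
  beta_reduce
  rw [levelPenalty_superlevel (σ b).2 (hK (σ b))]
  rcases exists_superlevel_or_one_le_levelPenalty hm ha S with ⟨t, ht, hS⟩ | hS
  · obtain rfl : S = K ⟨t, ht⟩ := by
      ext i
      rw [hS, hK]
    rw [levelPenalty_superlevel ht hS, hxK, hxK]
    have := hq b ⟨t, ht⟩
    linarith
  · have h1 := hM' b S
    have h2 := mul_le_mul_of_nonneg_left hS hM0
    linarith

end Valuation

end GraphicalAuction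

theorem mainTheorem3 (n m : ℕ) (aStar : Fin n → ℕ) (haStar : ∀ i, aStar i ≤ m) :
    ∃ a : GraphicalAuction.Coord (⊤ : SimpleGraph (Fin n)) → ℤ,
      GraphicalAuction.proj ⊤ a = (fun i => (aStar i : ℤ)) ∧
      (∀ (i j : Fin n) (h : s(i, j) ∈ (⊤ : SimpleGraph (Fin n)).edgeSet),
        a (Sum.inr ⟨s(i, j), h⟩) = min (aStar i : ℤ) (aStar j : ℤ)) ∧
      (∃ K : Fin m → Finset (Fin n), Antitone K ∧
        (∀ (t : Fin m) (i : Fin n), i ∈ K t ↔ (t : ℕ) + 1 ≤ aStar i) ∧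
        a = ∑ t, GraphicalAuction.bundleVec ⊤ (K t)) ∧
      ∀ v : Fin m → Finset (Fin n) → ℝ,
        (∀ b, GraphicalAuction.IsGraphicalValuation (⊤ : SimpleGraph (Fin n)) (v b)) →
        ∃ p : GraphicalAuction.Coord (⊤ : SimpleGraph (Fin n)) → ℝ,
          GraphicalAuction.HasCompetitiveEquilibrium ⊤ v a p := by
  classical
  let K : Fin m → Finset (Fin n) := fun t => Finset.univ.filter fun i => (t : ℕ) + 1 ≤ aStar i
  have hK : ∀ t i, i ∈ K t ↔ (t : ℕ) + 1 ≤ aStar i := fun t i => by simp [K]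
  -- Edge `ij` lies in the clique on `K t` iff `t + 1 ≤ min (aStar i) (aStar j)`, so vertex and edge
  -- coordinates are both such counts.
  have hcount : ∀ k ≤ m, ∑ t : Fin m, (if (t : ℕ) + 1 ≤ k then (1 : ℤ) else 0) = k := by
    intro k hk
    rw [Fin.sum_univ_eq_sum_range (fun t => if t + 1 ≤ k then (1 : ℤ) else 0) m,
      Finset.sum_boole]
    have : (Finset.range m).filter (fun t => t + 1 ≤ k) = Finset.range k := by
      ext t
      simp only [Finset.mem_filter, Finset.mem_range]
      omega
    rw [this, Finset.card_range]
  refine ⟨∑ t, GraphicalAuction.bundleVec ⊤ (K t), ?_, ?_, ⟨K, ?_, hK, rfl⟩, fun v _ =>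
    GraphicalAuction.exists_competitive_equilibrium_superlevel haStar K hK v⟩
  · funext i
    simp only [GraphicalAuction.proj, Finset.sum_apply, GraphicalAuction.bundleVec, hK]
    exact hcount _ (haStar i)
  · intro i j h
    simp only [Finset.sum_apply, GraphicalAuction.bundleVec, Sym2.mem_iff, forall_eq_or_imp,
      forall_eq, hK, ← le_min_iff]
    rw [hcount _ (min_le_of_left_le (haStar i)), Nat.cast_min]
  · intro s t hst i hi
    rw [hK] at hi ⊢
    have : (s : ℕ) ≤ t := hst
    omega
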